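/- Let $G$ be a finite group and $\mathbb{F}$ a field. For a finite-dimensional representation $V$ of $G$ over $\mathbb{F}$, let $\mathbb{F}[V]$ be the polynomial algebra in the coordinate functions on $V$ with respect to a basis, with the action of $G$ by algebra automorphisms given by $(g\cdot f)(v)=f(g^{-1}v)$, and let $\mathbb{F}[V]^G$ be the subalgebra of $G$-invariant polynomials. Let $\beta_{\mathrm{sep}}(G,V)$ be the minimal positive integer $d$ such that for all $v,w\in V$ with $G\cdot v\neq G\cdot w$ there is an $f\in\mathbb{F}[V]^G$ of degree at most $d$ with $f(v)\neq f(w)$. Let the separating Noether number $\beta_{\mathrm{sep}}^{\mathbb{F}}(G)$ be the maximum of $\beta_{\mathrm{sep}}(G,V)$ over all finite-dimensional representations $V$ of $G$ over $\mathbb{F}$. For the cyclic group $\mathrm{C}_p$ of prime order $p$ we have \[\beta_{\mathrm{sep}}^{\mathbb{Q}}(\mathrm{C}_p)=\begin{cases}3 & \text{for } p\ge 3,\\ 2 & \text{for } p=2,\end{cases}\] and this maximum is attained. In particular, for every finite-dimensional representation $V$ of $\mathrm{C}_p$ over $\mathbb{Q}$ and all $v,w\in V$ with different $\mathrm{C}_p$-orbits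 there is an $f\in\mathbb{Q}[V]^{\mathrm{C}_p}$ of degree at most $3$ with $f(v)\neq f(w)$. -/

import Mathlib

noncomputable section

namespace SepInv

universe u k w

section Basis

variable {F : Type k} [Field F] {G : Type u} [Group G] {V : Type w} [AddCommGroup V] [Module F V]
  {ι : Type*} [Fintype ι] [DecidableEq ι]

/-- The action of `g` on the coordinate ring `F[V]`, the polynomial ring in the coordinate
functions of the basis `b`: the variable `x i` is sent to the linear form
`v ↦ x i (ρ g⁻¹ v)`, and this is extended to an `F`-algebra endomorphism. -/
def polyAction (b : Module.Basis ι F V) (ρ : Representation F G V) (g : G) :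
    MvPolynomial ι F →ₐ[F] MvPolynomial ι F :=
  MvPolynomial.bind₁ fun i => LinearMap.toMvPolynomial b b (ρ g⁻¹) i

/-- The defining property `(g • f)(v) = f(g⁻¹ v)` of the action on polynomials. -/
theorem eval_polyAction (b : Module.Basis ι F V) (ρ : Representation F G V) (g : G)
    (f : MvPolynomial ι F) (v : V) :
    MvPolynomial.eval (b.repr v) (polyAction b ρ g f) =
      MvPolynomial.eval (b.repr (ρ g⁻¹ v)) f := by
  have h : (MvPolynomial.aeval (b.repr v : ι → F)).comp (polyAction b ρ g) =
      MvPolynomial.aeval (b.repr (ρ g⁻¹ v) : ι → F) := by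
    apply MvPolynomial.algHom_ext
    intro i
    simp [polyAction, MvPolynomial.aeval_eq_eval, LinearMap.toMvPolynomial_eval_eq_apply]
  have h2 := DFunLike.congr_fun h f
  simpa [MvPolynomial.aeval_eq_eval] using h2

/-- The algebra `F[V]^G` of polynomial invariants, in the coordinates of the basis `b`. -/
def invariants (b : Module.Basis ι F V) (ρ : Representation F G V) :
    Subalgebra F (MvPolynomial ι F) :=
  ⨅ g : G, AlgHom.equalizer (polyAction b ρ g) (AlgHom.id F (MvPolynomial ι F))

theorem mem_invariants (b : Module.Basis ι F V) (ρ : Representation F G V)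
    (f : MvPolynomial ι F) : f ∈ invariants b ρ ↔ ∀ g : G, polyAction b ρ g f = f := by
  simp [invariants, Algebra.mem_iInf, AlgHom.mem_equalizer]

end Basis

section Numbers

variable {F : Type k} [Field F] {G : Type u} [Group G] {V : Type w} [AddCommGroup V] [Module F V]

/-- The orbit `G • v`. -/
def orbit (ρ : Representation F G V) (v : V) : Set V := Set.range fun g : G => ρ g v

variable [FiniteDimensional F V]

/-- Any two vectors with different orbits are separated by an invariant of degree at most `d`. -/
def SeparatesInDegree (ρ : Representation F G V) (d : ℕ) : Prop :=
  ∀ v w : V, orbit ρ v ≠ orbit ρ w →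
    ∃ f ∈ invariants (Module.finBasis F V) ρ, f.totalDegree ≤ d ∧
      MvPolynomial.eval ((Module.finBasis F V).repr v) f ≠
        MvPolynomial.eval ((Module.finBasis F V).repr w) f

/-- `β_sep(G, V)`: the minimal positive integer `d` such that the invariants of degree at most `d`
separate the orbits (`⊤` if there were no such `d`). -/
def betaSep (ρ : Representation F G V) : ℕ∞ :=
  sInf {n : ℕ∞ | ∃ d : ℕ, 0 < d ∧ SeparatesInDegree ρ d ∧ n = d}

end Numbers

/-- The values `β_sep(G, V)`, where `V` ranges over the finite dimensional representations of `G`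
over `F`. -/
def betaSepValues (F : Type k) [Field F] (G : Type u) [Group G] : Set ℕ∞ :=
  {n | ∃ (V : Type w) (_ : AddCommGroup V) (_ : Module F V) (_ : FiniteDimensional F V)
    (ρ : Representation F G V), n = betaSep ρ}

/-- The separating Noether number of `G` over `F`, the supremum in `ℕ∞` of the values
`β_sep(G, V)`. -/
def separatingNoetherNumber (F : Type k) [Field F] (G : Type u) [Group G] : ℕ∞ :=
  sSup (betaSepValues.{u, k, w} F G)

end SepInv

end

universe u w

/-!
Let `G` have prime order `p`, let `V` be a rational representation, and suppose that the invariants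
of degree at most `3` agree at `v` and `w`. For a character `χ : G →* ℂˣ` and a rational linear form
`φ` on `V`, the eigenform `A(φ, χ)(v) = ∑ g, χ(g)⁻¹ φ(g v)` is multiplied by `χ(h)` when `v` is
replaced by `h v`. A product of at most three eigenforms whose characters multiply to `1` is a
complex combination of rational invariants of degree at most `3`, so it takes the same value at `v`
and `w` (`SepInv.AgreeInDegree.prod_eigenform_eq`).

Irreducibility of the cyclotomic polynomial over `ℚ` is what brings the degree down to `3`: the
values `A(φ, χ)(v)` for nontrivial `χ` are Galois conjugate, so they vanish together
(`SepInv.eigenform_eq_zero`). If all of them vanish for every `φ`, then `v` is fixed by `G`, and so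
is `w`, and the invariant linear forms give `v = w`. Otherwise choose `φ` such that
`A(φ, χ)(v) ≠ 0` for all `χ ≠ 1` and put `c(χ) = A(φ, χ)(w) / A(φ, χ)(v)`. The quadratic invariants
show that `c(χ) c(χ⁻¹) = 1` and that `A(φ', χ)(w) = c(χ) A(φ', χ)(v)` for every `φ'`; the cubic ones
show that `c(χ ψ) = c(χ) c(ψ)` when `χ`, `ψ` and `χ ψ` are nontrivial. Hence `c(χ ^ k) = c(χ) ^ k`
for `0 < k < p` and `c(χ) ^ p = 1`, so `c(χ) = χ(h)` for some `h` in `G`, and `w = h v`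
(`SepInv.AgreeInDegree.orbit_eq`). For `p = 2` there is only one nontrivial character, and no cubic
invariants are needed.

For the lower bound let `v ≠ 0` be a vector of the regular representation whose orbit sum is `0`.
Invariant linear forms vanish at `v`, so invariants of degree at most `1` do not separate `v` from
`0`, and invariants of degree at most `2` do not separate `v` from `-v`. For odd `p` the vector `-v`
is not in the orbit of `v`, as no element of `G` has even order.
-/

namespace SepInv

open MvPolynomial

/-! ### Invariants and transfers of products of linear forms -/

section Invariants

variable {F : Type*} [Field F] {G : Type*} [Group G] {V : Type*} [AddCommGroup V] [Module F V]

theorem mem_invariants_iff_eval [Infinite F] {ι : Type*} [Fintype ι] [DecidableEq ι]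
    (b : Module.Basis ι F V) (ρ : Representation F G V) (f : MvPolynomial ι F) :
    f ∈ invariants b ρ ↔ ∀ (g : G) (v : V), eval (b.repr (ρ g v)) f = eval (b.repr v) f := by
  rw [mem_invariants]
  constructor
  · intro h g v
    have := eval_polyAction b ρ g⁻¹ f v
    rw [h, inv_inv] at this
    exact this.symm
  · intro h g
    refine MvPolynomial.funext fun x => ?_
    have := eval_polyAction b ρ g f (b.equivFun.symm x)
    rw [h] at this
    have hx : (b.repr (b.equivFun.symm x) : ι → F) = x := b.equivFun.apply_symm_apply x
    rwa [hx] at this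

theorem orbit_apply (ρ : Representation F G V) (g : G) (v : V) :
    orbit ρ (ρ g v) = orbit ρ v := by
  ext x
  constructor
  · rintro ⟨h, rfl⟩
    exact ⟨h * g, by simp⟩
  · rintro ⟨h, rfl⟩
    exact ⟨h * g⁻¹, by simp [← Module.End.mul_apply, ← map_mul]⟩

theorem mem_orbit_self (ρ : Representation F G V) (v : V) : v ∈ orbit ρ v := ⟨1, by simp⟩

variable [FiniteDimensional F V]

theorem SeparatesInDegree.mono {ρ : Representation F G V} {d e : ℕ}
    (h : SeparatesInDegree ρ d) (hde : d ≤ e) : SeparatesInDegree ρ e := fun v w hvw =>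
  let ⟨f, hf, hd, hne⟩ := h v w hvw
  ⟨f, hf, hd.trans hde, hne⟩

/-- The vectors `v` and `w` are not distinguished by any invariant of degree at most `d`. -/
def AgreeInDegree (ρ : Representation F G V) (d : ℕ) (v w : V) : Prop :=
  ∀ f ∈ invariants (Module.finBasis F V) ρ, f.totalDegree ≤ d →
    eval ((Module.finBasis F V).repr v) f = eval ((Module.finBasis F V).repr w) f

theorem separatesInDegree_iff {ρ : Representation F G V} {d : ℕ} :
    SeparatesInDegree ρ d ↔ ∀ v w, AgreeInDegree ρ d v w → orbit ρ v = orbit ρ w := by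
  refine forall₂_congr fun v w => ?_
  rw [← not_imp_not, not_not]
  simp only [AgreeInDegree, not_exists, not_and, not_not, ne_eq]

/-- The transfer of a product of `n ≤ d` linear forms is an invariant of degree at most `d`. -/
theorem AgreeInDegree.sum_prod_eq [Infinite F] [Fintype G] {ρ : Representation F G V} {d : ℕ}
    {v w : V} (h : AgreeInDegree ρ d v w) {n : ℕ} (hn : n ≤ d) (φ : Fin n → Module.Dual F V) :
    ∑ g, ∏ i, φ i (ρ g v) = ∑ g, ∏ i, φ i (ρ g w) := by
  let b := Module.finBasis F V
  let lin (ψ : Module.Dual F V) : MvPolynomial _ F :=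
    LinearMap.toMvPolynomial b (Module.Basis.singleton Unit F) ψ ()
  have hlin (ψ : Module.Dual F V) (u : V) : eval (b.repr u) (lin ψ) = ψ u := by
    simp [lin, LinearMap.toMvPolynomial_eval_eq_apply]
  let f : MvPolynomial _ F := ∑ g, ∏ i, lin (φ i ∘ₗ ρ g)
  have hf (u : V) : eval (b.repr u) f = ∑ g, ∏ i, φ i (ρ g u) := by
    simp [f, map_sum, map_prod, hlin]
  rw [← hf, ← hf]
  refine h f ((mem_invariants_iff_eval b ρ f).2 fun g u => ?_) ?_
  · rw [hf, hf]
    refine Fintype.sum_equiv (Equiv.mulRight g) _ _ fun x => ?_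
    simp
  · refine totalDegree_finsetSum_le fun g _ => (totalDegree_finsetProd _ _).trans ?_
    refine (Finset.sum_le_card_nsmul _ _ 1 fun i _ =>
      LinearMap.toMvPolynomial_totalDegree_le ..).trans ?_
    simpa using hn

end Invariants

/-! ### Eigenforms of the characters -/

section Eigenforms

variable {G : Type*} [Group G] [Fintype G] {V : Type*} [AddCommGroup V] [Module ℚ V]

/-- The complex-valued linear form obtained by projecting the rational linear form `φ` to the
`χ`-isotypic part: it satisfies `eigenform ρ φ χ (ρ h v) = χ h * eigenform ρ φ χ v`. It is
`|G|` times the usual projection, and is encoded as a plain function, as only its values are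
used. -/
def eigenform (ρ : Representation ℚ G V) (φ : Module.Dual ℚ V) (χ : G →* ℂˣ) (v : V) : ℂ :=
  ∑ g, ((χ g)⁻¹ : ℂˣ) * (φ (ρ g v) : ℂ)

variable {ρ : Representation ℚ G V}

theorem eigenform_apply (φ : Module.Dual ℚ V) (χ : G →* ℂˣ) (h : G) (v : V) :
    eigenform ρ φ χ (ρ h v) = χ h * eigenform ρ φ χ v := by
  rw [eigenform, eigenform, Finset.mul_sum]
  refine Fintype.sum_equiv (Equiv.mulRight h) _ _ fun g => ?_
  simp only [Equiv.coe_mulRight, map_mul, Module.End.mul_apply, mul_inv, Units.val_mul]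
  have : ((χ h : ℂˣ) : ℂ) * ((χ h)⁻¹ : ℂˣ) = 1 := Units.mul_inv _
  linear_combination (-(((χ g)⁻¹ : ℂˣ) : ℂ) * (φ (ρ g (ρ h v)) : ℂ)) * this

variable [FiniteDimensional ℚ V]

/-- A product of at most `d` eigenforms whose characters multiply to `1` is a complex combination
of rational invariants of degree at most `d`. -/
theorem AgreeInDegree.prod_eigenform_eq {d : ℕ} {v w : V} (hvw : AgreeInDegree ρ d v w) {n : ℕ}
    (hn : n ≤ d) (φ : Fin n → Module.Dual ℚ V) (χ : Fin n → (G →* ℂˣ)) (hχ : ∏ i, χ i = 1) :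
    ∏ i, eigenform ρ (φ i) (χ i) v = ∏ i, eigenform ρ (φ i) (χ i) w := by
  -- Averaging over the diagonal translations of `G ^ n` turns the expanded product into
  -- transfers of products of linear forms.
  have key (u : V) : (Fintype.card G : ℂ) * ∏ i, eigenform ρ (φ i) (χ i) u =
      ∑ f : Fin n → G, (∏ i, (((χ i (f i))⁻¹ : ℂˣ) : ℂ)) *
        ((∑ h, ∏ i, (φ i ∘ₗ ρ (f i)) (ρ h u) : ℚ) : ℂ) := by
    have inv (h : G) : ∏ i, eigenform ρ (φ i) (χ i) u =
        ∏ i, eigenform ρ (φ i) (χ i) (ρ h u) := by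
      simp_rw [eigenform_apply, Finset.prod_mul_distrib]
      have : ∏ i, ((χ i h : ℂˣ) : ℂ) = 1 := by
        have := congrArg (fun ψ : G →* ℂˣ => ((ψ h : ℂˣ) : ℂ)) hχ
        simpa [MonoidHom.finsetProd_apply] using this
      rw [this, one_mul]
    have : (Fintype.card G : ℂ) * ∏ i, eigenform ρ (φ i) (χ i) u =
        ∑ h, ∏ i, eigenform ρ (φ i) (χ i) (ρ h u) := by
      simp [← inv]
    rw [this]
    simp_rw [eigenform, Finset.prod_univ_sum, Fintype.piFinset_univ, Finset.prod_mul_distrib]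
    rw [Finset.sum_comm]
    refine Finset.sum_congr rfl fun f _ => ?_
    rw [← Finset.mul_sum]
    simp
  have hcard : (Fintype.card G : ℂ) ≠ 0 := Nat.cast_ne_zero.2 Fintype.card_ne_zero
  apply mul_left_cancel₀ hcard
  rw [key, key]
  exact Finset.sum_congr rfl fun f _ => by rw [hvw.sum_prod_eq hn]

theorem AgreeInDegree.eigenform_one_eq {d : ℕ} {v w : V} (hvw : AgreeInDegree ρ d v w)
    (hd : 1 ≤ d) (φ : Module.Dual ℚ V) : eigenform ρ φ 1 v = eigenform ρ φ 1 w := by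
  simpa using hvw.prod_eigenform_eq hd ![φ] ![1] (by simp)

theorem AgreeInDegree.eigenform_mul_eq {d : ℕ} {v w : V} (hvw : AgreeInDegree ρ d v w)
    (hd : 2 ≤ d) (φ ψ : Module.Dual ℚ V) (χ : G →* ℂˣ) :
    eigenform ρ φ χ v * eigenform ρ ψ χ⁻¹ v = eigenform ρ φ χ w * eigenform ρ ψ χ⁻¹ w := by
  simpa using hvw.prod_eigenform_eq hd ![φ, ψ] ![χ, χ⁻¹]
    (by rw [Fin.prod_univ_two]; exact mul_inv_cancel χ)

theorem AgreeInDegree.eigenform_mul_mul_eq {d : ℕ} {v w : V} (hvw : AgreeInDegree ρ d v w)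
    (hd : 3 ≤ d) (φ : Module.Dual ℚ V) (χ ψ : G →* ℂˣ) :
    eigenform ρ φ χ v * eigenform ρ φ ψ v * eigenform ρ φ (χ * ψ)⁻¹ v =
      eigenform ρ φ χ w * eigenform ρ φ ψ w * eigenform ρ φ (χ * ψ)⁻¹ w := by
  simpa [Fin.prod_univ_three] using
    hvw.prod_eigenform_eq hd ![φ, φ, φ] ![χ, ψ, (χ * ψ)⁻¹]
      (by rw [Fin.prod_univ_three]; exact mul_inv_cancel (χ * ψ))

end Eigenforms

/-! ### Separation of orbits for groups of prime order -/

section PrimeOrder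

variable {G : Type*} [Group G] {p : ℕ} [hp : Fact p.Prime]

theorem character_inv_ne_one {χ : G →* ℂˣ} (hχ : χ ≠ 1) : χ⁻¹ ≠ 1 :=
  fun h => hχ (MonoidHom.ext fun g => inv_eq_one.1 (DFunLike.congr_fun h g))

/-- A nontrivial character of a group of prime order maps a nontrivial element to a primitive
root of unity. -/
theorem isPrimitiveRoot_apply (hG : Nat.card G = p) {χ : G →* ℂˣ} (hχ : χ ≠ 1) {g : G}
    (hg : g ≠ 1) : IsPrimitiveRoot (χ g : ℂ) p := by
  have hgen (x : G) : x ∈ Subgroup.zpowers g := mem_zpowers_of_prime_card hG hg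
  refine IsPrimitiveRoot.coe_units_iff.2 ?_
  have hne : χ g ≠ 1 := fun h => hχ <| by
    ext x
    obtain ⟨n, rfl⟩ := hgen x
    simp [h]
  have hpow : χ g ^ p = 1 := by rw [← map_pow, ← hG, pow_card_eq_one', map_one]
  exact orderOf_eq_prime hpow hne ▸ IsPrimitiveRoot.orderOf (χ g)

theorem exists_character_ne_one (hG : Nat.card G = p) : ∃ χ : G →* ℂˣ, χ ≠ 1 := by
  have : Finite G := Nat.finite_of_card_ne_zero (hG ▸ hp.out.ne_zero)
  have : Nontrivial G := Finite.one_lt_card_iff_nontrivial.1 (hG ▸ hp.out.one_lt)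
  obtain ⟨g, hg⟩ := exists_ne (1 : G)
  have hgen (x : G) : x ∈ Subgroup.zpowers g := mem_zpowers_of_prime_card hG hg
  have hζ := Complex.isPrimitiveRoot_exp p hp.out.ne_zero
  obtain ⟨u, hu⟩ := hζ.isUnit hp.out.ne_zero
  rw [← hu, IsPrimitiveRoot.coe_units_iff] at hζ
  have hord : orderOf u ∣ orderOf g := by
    rw [← hζ.eq_orderOf, orderOf_eq_card_of_forall_mem_zpowers hgen, hG]
  refine ⟨monoidHomOfForallMemZpowers hgen hord, fun h => hζ.ne_one hp.out.one_lt ?_⟩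
  rw [← monoidHomOfForallMemZpowers_apply_gen hgen hord, h, MonoidHom.one_apply]

theorem character_pow_ne_one (hG : Nat.card G = p) {χ : G →* ℂˣ} (hχ : χ ≠ 1) {k : ℕ}
    (hk0 : k ≠ 0) (hk : k < p) : χ ^ k ≠ 1 := by
  have : Finite G := Nat.finite_of_card_ne_zero (hG ▸ hp.out.ne_zero)
  have : Nontrivial G := Finite.one_lt_card_iff_nontrivial.1 (hG ▸ hp.out.one_lt)
  obtain ⟨g, hg⟩ := exists_ne (1 : G)
  intro h
  refine (isPrimitiveRoot_apply hG hχ hg).pow_ne_one_of_pos_of_lt hk0 hk ?_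
  simpa using congrArg (fun ψ : G →* ℂˣ => ((ψ g : ℂˣ) : ℂ)) h

variable [Fintype G] {V : Type*} [AddCommGroup V] [Module ℚ V] {ρ : Representation ℚ G V}

/-- The eigenforms of the nontrivial characters are Galois conjugate, so they vanish at the same
rational vectors. -/
theorem eigenform_eq_zero (hG : Nat.card G = p) {χ ψ : G →* ℂˣ} (hχ : χ ≠ 1) (hψ : ψ ≠ 1)
    {φ : Module.Dual ℚ V} {v : V} (h : eigenform ρ φ χ v = 0) : eigenform ρ φ ψ v = 0 := by
  have : Nontrivial G := Finite.one_lt_card_iff_nontrivial.1 (hG ▸ hp.out.one_lt)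
  obtain ⟨g, hg⟩ := exists_ne (1 : G)
  have hgen (x : G) : x ∈ Subgroup.zpowers g := mem_zpowers_of_prime_card hG hg
  let q : Polynomial ℚ := ∑ j ∈ Finset.range p, Polynomial.monomial j (φ (ρ (g ^ j) v))
  have hq (θ : G →* ℂˣ) : Polynomial.aeval ((θ g : ℂ)⁻¹) q = eigenform ρ φ θ v := by
    classical
    have himg : Finset.image (fun i => g ^ i) (Finset.range p) = Finset.univ := by
      rw [← hG, ← orderOf_eq_card_of_forall_mem_zpowers hgen]
      simpa using IsCyclic.image_range_orderOf hgen
    rw [eigenform, ← himg, Finset.sum_image, map_sum]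
    · refine Finset.sum_congr rfl fun j _ => ?_
      simp [Polynomial.aeval_monomial, mul_comm]
    · intro i hi j hj hij
      have hord : orderOf g = p := by rw [orderOf_eq_card_of_forall_mem_zpowers hgen, hG]
      exact pow_injOn_Iio_orderOf (by simpa [hord] using hi) (by simpa [hord] using hj) hij
  have hprim (θ : G →* ℂˣ) (hθ : θ ≠ 1) : IsPrimitiveRoot ((θ g : ℂ)⁻¹) p :=
    (isPrimitiveRoot_apply hG hθ hg).inv
  rw [← hq] at h ⊢
  have hdvd : minpoly ℚ ((ψ g : ℂ)⁻¹) ∣ q := by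
    rw [← Polynomial.cyclotomic_eq_minpoly_rat (hprim ψ hψ) hp.out.pos,
      Polynomial.cyclotomic_eq_minpoly_rat (hprim χ hχ) hp.out.pos]
    exact minpoly.dvd _ _ h
  exact Polynomial.aeval_eq_zero_of_dvd_aeval_eq_zero hdvd (minpoly.aeval _ _)

theorem sum_eigenform (hG : Nat.card G = p) {χ : G →* ℂˣ} (hχ : χ ≠ 1) (φ : Module.Dual ℚ V)
    (v : V) : ∑ k ∈ Finset.range p, eigenform ρ φ (χ ^ k) v = p * φ v := by
  simp_rw [eigenform]
  rw [Finset.sum_comm]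
  simp_rw [← Finset.sum_mul]
  rw [Finset.sum_eq_single 1]
  · simp
  · intro g _ hg
    have := (isPrimitiveRoot_apply hG hχ hg).inv.geom_sum_eq_zero hp.out.one_lt
    simp [← inv_pow, this]
  · simp

theorem eq_of_eigenform_eq (hG : Nat.card G = p) {χ : G →* ℂˣ} (hχ : χ ≠ 1) {v w : V}
    (h : ∀ φ : Module.Dual ℚ V, ∀ k < p, eigenform ρ φ (χ ^ k) v = eigenform ρ φ (χ ^ k) w) :
    v = w := by
  rw [← sub_eq_zero, ← Module.forall_dual_apply_eq_zero_iff ℚ]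
  intro φ
  have h1 : (p : ℂ) * φ v = p * φ w := by
    rw [← sum_eigenform (ρ := ρ) hG hχ, ← sum_eigenform (ρ := ρ) hG hχ]
    exact Finset.sum_congr rfl fun k hk => h φ k (Finset.mem_range.1 hk)
  have h2 := mul_left_cancel₀ (Nat.cast_ne_zero.2 hp.out.ne_zero) h1
  rw [map_sub, sub_eq_zero]
  exact_mod_cast h2

variable [FiniteDimensional ℚ V]

/-- The ratios `c ψ` of the values at `w` and `v` of the eigenforms of a fixed `φ` satisfy
`c (χ ^ k) = c χ ^ k`. For `p = 2` only the trivial case `k = 1` occurs, which is why degree `2`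
suffices then. -/
theorem AgreeInDegree.eigenform_div_pow (hG : Nat.card G = p) {v w : V} {d : ℕ} (hd : 2 ≤ d)
    (hd' : p ≠ 2 → 3 ≤ d) (hvw : AgreeInDegree ρ d v w) {φ : Module.Dual ℚ V}
    {χ : G →* ℂˣ} (hχ : χ ≠ 1) (hφ : ∀ ψ : G →* ℂˣ, ψ ≠ 1 → eigenform ρ φ ψ v ≠ 0)
    {k : ℕ} (hk0 : 1 ≤ k) (hk : k < p) :
    eigenform ρ φ (χ ^ k) w / eigenform ρ φ (χ ^ k) v =
      (eigenform ρ φ χ w / eigenform ρ φ χ v) ^ k := by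
  induction k, hk0 using Nat.le_induction with
  | base => rw [show χ ^ 1 = χ from pow_one χ, pow_one]
  | succ k hk0 ih =>
    have hχk := character_pow_ne_one hG hχ (by lia : k ≠ 0) (by lia)
    have hχk' := character_pow_ne_one hG hχ (by lia : k + 1 ≠ 0) hk
    have hvk' := hφ _ (character_inv_ne_one hχk')
    have h2 := hvw.eigenform_mul_eq hd φ φ (χ ^ (k + 1))
    have h3 := hvw.eigenform_mul_mul_eq (hd' (by lia)) φ (χ ^ k) χ
    rw [show χ ^ k * χ = χ ^ (k + 1) from (pow_succ χ k).symm] at h3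
    have hw : eigenform ρ φ (χ ^ (k + 1))⁻¹ w ≠ 0 := by
      refine right_ne_zero_of_mul (a := eigenform ρ φ (χ ^ (k + 1)) w) ?_
      rw [← h2]
      exact mul_ne_zero (hφ _ hχk') hvk'
    rw [pow_succ, ← ih (by lia)]
    have hv1 := hφ _ hχ
    have hvk := hφ _ hχk
    have hvk1 := hφ _ hχk'
    rw [div_mul_div_comm, div_eq_div_iff hvk1 (mul_ne_zero hvk hv1)]
    apply mul_right_cancel₀ hw
    linear_combination (-eigenform ρ φ (χ ^ k) v * eigenform ρ φ χ v) * h2 +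
      eigenform ρ φ (χ ^ (k + 1)) v * h3

/-- Invariants of degree at most `3` separate the orbits of a group of prime order `p` on a
rational representation, and degree `2` suffices for `p = 2`. -/
theorem AgreeInDegree.orbit_eq (hG : Nat.card G = p) {v w : V} {d : ℕ} (hd : 2 ≤ d)
    (hd' : p ≠ 2 → 3 ≤ d) (hvw : AgreeInDegree ρ d v w) : orbit ρ v = orbit ρ w := by
  obtain ⟨χ, hχ⟩ := exists_character_ne_one hG
  by_cases hφ : ∀ φ : Module.Dual ℚ V, eigenform ρ φ χ v = 0
  · have hv (φ : Module.Dual ℚ V) {ψ : G →* ℂˣ} (hψ : ψ ≠ 1) : eigenform ρ φ ψ v = 0 :=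
      eigenform_eq_zero hG hχ hψ (hφ φ)
    have hw (φ : Module.Dual ℚ V) {ψ : G →* ℂˣ} (hψ : ψ ≠ 1) : eigenform ρ φ ψ w = 0 := by
      have h := hvw.eigenform_mul_eq hd φ φ ψ
      rw [hv φ hψ, zero_mul, eq_comm, mul_eq_zero] at h
      exact h.elim id fun h => eigenform_eq_zero hG (character_inv_ne_one hψ) hψ h
    suffices v = w by rw [this]
    refine eq_of_eigenform_eq (ρ := ρ) hG hχ fun φ k hk => ?_
    rcases eq_or_ne k 0 with rfl | hk0
    · exact hvw.eigenform_one_eq (by lia) φ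
    · have := character_pow_ne_one hG hχ hk0 hk
      rw [hv φ this, hw φ this]
  · push Not at hφ
    obtain ⟨φ, hφ⟩ := hφ
    have hv (ψ : G →* ℂˣ) (hψ : ψ ≠ 1) : eigenform ρ φ ψ v ≠ 0 :=
      fun h => hφ (eigenform_eq_zero hG hψ hχ h)
    have hw (ψ : G →* ℂˣ) (hψ : ψ ≠ 1) : eigenform ρ φ ψ w ≠ 0 := by
      refine left_ne_zero_of_mul (b := eigenform ρ φ ψ⁻¹ w) ?_
      rw [← hvw.eigenform_mul_eq hd φ φ ψ]
      exact mul_ne_zero (hv _ hψ) (hv _ (character_inv_ne_one hψ))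
    let c (ψ : G →* ℂˣ) : ℂ := eigenform ρ φ ψ w / eigenform ρ φ ψ v
    -- Degree `2`: the scaling factor from `v` to `w` on the `ψ`-part does not depend on the form.
    have hscale (φ' : Module.Dual ℚ V) {ψ : G →* ℂˣ} (hψ : ψ ≠ 1) :
        eigenform ρ φ' ψ w = c ψ * eigenform ρ φ' ψ v := by
      have hψ' := character_inv_ne_one hψ
      have h1 := hvw.eigenform_mul_eq hd φ φ ψ
      have h2 := hvw.eigenform_mul_eq hd φ' φ ψ
      have hv1 := hv _ hψ
      rw [div_mul_eq_mul_div, eq_div_iff hv1]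
      apply mul_right_cancel₀ (mul_ne_zero (hv _ hψ') (hw _ hψ'))
      linear_combination (-eigenform ρ φ ψ v * eigenform ρ φ ψ⁻¹ v) * h2 +
        (eigenform ρ φ' ψ v * eigenform ρ φ ψ⁻¹ v) * h1
    have hpow {k : ℕ} (hk0 : 1 ≤ k) (hk : k < p) : c (χ ^ k) = c χ ^ k :=
      hvw.eigenform_div_pow hG hd hd' hχ hv hk0 hk
    have hχp : χ ^ p = 1 := by
      ext g
      simp [← map_pow, ← hG]
    have hcp : c χ ^ p = 1 := by
      have hp1 := hp.out.two_le
      have hinv : χ ^ (p - 1) = χ⁻¹ := by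
        have h : χ ^ (p - 1) * χ = 1 := by
          rw [show χ ^ (p - 1) * χ = χ ^ (p - 1 + 1) from (pow_succ χ _).symm,
            Nat.sub_add_cancel (by lia), hχp]
        exact MonoidHom.ext fun g => eq_inv_of_mul_eq_one_left (DFunLike.congr_fun h g)
      have := hpow (by lia : 1 ≤ p - 1) (by lia)
      rw [← Nat.sub_add_cancel (by lia : 1 ≤ p), pow_succ, ← this, hinv]
      simp only [c]
      rw [div_mul_div_comm, div_eq_one_iff_eq
        (mul_ne_zero (hv _ (character_inv_ne_one hχ)) (hv _ hχ)), mul_comm,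
        ← hvw.eigenform_mul_eq hd φ φ χ, mul_comm]
    have : Nontrivial G := Finite.one_lt_card_iff_nontrivial.1 (hG ▸ hp.out.one_lt)
    obtain ⟨g, hg⟩ := exists_ne (1 : G)
    obtain ⟨j, -, hj⟩ := (isPrimitiveRoot_apply hG hχ hg).eq_pow_of_pow_eq_one hcp
    suffices w = ρ (g ^ j) v by rw [this, orbit_apply]
    refine eq_of_eigenform_eq (ρ := ρ) hG hχ fun φ' k hk => ?_
    rw [eigenform_apply]
    rcases eq_or_ne k 0 with rfl | hk0
    · rw [show χ ^ 0 = 1 from pow_zero χ, ← hvw.eigenform_one_eq (by lia) φ']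
      simp
    · rw [hscale φ' (character_pow_ne_one hG hχ hk0 hk), hpow (by lia) hk, ← hj]
      simp

end PrimeOrder

/-! ### Values of homogeneous polynomials -/

section Homogeneous

variable {R ι : Type*} [CommRing R] {f : MvPolynomial ι R}

theorem eval_sum_of_isHomogeneous_one {κ : Type*} (hf : f.IsHomogeneous 1) (s : Finset κ)
    (x : κ → ι → R) : eval (∑ k ∈ s, x k) f = ∑ k ∈ s, eval (x k) f := by
  have hf' : f ∈ homogeneousSubmodule ι R 1 := hf
  rw [homogeneousSubmodule_one_eq_span_X] at hf'
  clear hf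
  induction hf' using Submodule.span_induction with
  | mem x h => obtain ⟨i, rfl⟩ := h; simp
  | zero => simp
  | add p q _ _ hp hq => simp [hp, hq, Finset.sum_add_distrib]
  | smul a p _ hp => simp [hp, Finset.mul_sum, smul_eval]

theorem eval_of_isHomogeneous_zero (hf : f.IsHomogeneous 0) (x y : ι → R) :
    eval x f = eval y f := by
  rw [totalDegree_eq_zero_iff_eq_C.1 (Nat.le_zero.1 hf.totalDegree_le)]
  simp

theorem eval_neg_of_isHomogeneous {n : ℕ} (hf : f.IsHomogeneous n) (x : ι → R) :
    eval (-x) f = (-1) ^ n * eval x f := by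
  rw [eval_eq, eval_eq, Finset.mul_sum]
  refine Finset.sum_congr rfl fun m hm => ?_
  have hm' : ∑ i ∈ m.support, m i = n := by
    rw [← hf (mem_support_iff.1 hm), Finsupp.weight_apply]
    simp [Finsupp.sum]
  rw [← hm', ← Finset.prod_pow_eq_pow_sum]
  simp_rw [Pi.neg_apply, neg_pow (x _), Finset.prod_mul_distrib]
  ring

theorem eval_eq_sum_homogeneousComponent {n : ℕ} (hf : f.totalDegree < n) (x : ι → R) :
    eval x f = ∑ i ∈ Finset.range n, eval x (homogeneousComponent i f) := by
  conv_lhs => rw [← sum_homogeneousComponent f, map_sum]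
  refine Finset.sum_subset (Finset.range_mono hf) fun i _ hi => ?_
  rw [homogeneousComponent_eq_zero _ _ (by simpa using hi), map_zero]

end Homogeneous

/-! ### Vectors not separated in low degree -/

section LowerBound

variable {F : Type*} [Field F] [CharZero F] {G : Type*} [Group G] [Fintype G]
  {V : Type*} [AddCommGroup V] [Module F V] {ι : Type*} [Fintype ι] [DecidableEq ι]
  {b : Module.Basis ι F V} {ρ : Representation F G V} {f : MvPolynomial ι F} {v : V}

/-- In degree at most `2`, twice the linear part of `f` is `f(v) - f(-v)`, so it is invariant
together with `f`; hence it vanishes at every `v` whose orbit sum is zero. -/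
theorem eval_homogeneousComponent_one_eq_zero (hf : f ∈ invariants b ρ) (hd : f.totalDegree ≤ 2)
    (hv : ∑ g, ρ g v = 0) : eval (b.repr v) (homogeneousComponent 1 f) = 0 := by
  rw [mem_invariants_iff_eval] at hf
  have odd (u : V) : 2 * eval (b.repr u) (homogeneousComponent 1 f) =
      eval (b.repr u) f - eval (b.repr (-u)) f := by
    have h0 := eval_neg_of_isHomogeneous (homogeneousComponent_isHomogeneous 0 f) (b.repr u)
    have h1 := eval_neg_of_isHomogeneous (homogeneousComponent_isHomogeneous 1 f) (b.repr u)
    have h2 := eval_neg_of_isHomogeneous (homogeneousComponent_isHomogeneous 2 f) (b.repr u)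
    rw [eval_eq_sum_homogeneousComponent (Nat.lt_succ_of_le hd),
      eval_eq_sum_homogeneousComponent (Nat.lt_succ_of_le hd)]
    simp only [Finset.sum_range_succ, Finset.sum_range_zero, map_neg, Finsupp.coe_neg, h0, h1, h2]
    ring
  have inv (g : G) : eval (b.repr (ρ g v)) (homogeneousComponent 1 f) =
      eval (b.repr v) (homogeneousComponent 1 f) := by
    apply mul_left_cancel₀ (two_ne_zero (α := F))
    rw [odd, odd, ← map_neg, hf, hf]
  have hsum := eval_sum_of_isHomogeneous_one (homogeneousComponent_isHomogeneous 1 f)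
    Finset.univ fun g => (b.repr (ρ g v) : ι → F)
  have h0 : ∑ g, (b.repr (ρ g v) : ι → F) = 0 := by
    rw [← Finsupp.coe_finsetSum, ← map_sum, hv, map_zero, Finsupp.coe_zero]
  have h1 := eval_sum_of_isHomogeneous_one (homogeneousComponent_isHomogeneous 1 f)
    (∅ : Finset G) fun _ => 0
  rw [Finset.sum_empty, Finset.sum_empty] at h1
  rw [h0, h1] at hsum
  simpa [inv] using hsum.symm

variable [FiniteDimensional F V]

theorem agreeInDegree_two_neg (hv : ∑ g, ρ g v = 0) : AgreeInDegree ρ 2 v (-v) := by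
  intro f hf hd
  have h1 := eval_homogeneousComponent_one_eq_zero hf hd hv
  have h (i : ℕ) := eval_neg_of_isHomogeneous (homogeneousComponent_isHomogeneous i f)
    ((Module.finBasis F V).repr v)
  rw [eval_eq_sum_homogeneousComponent (Nat.lt_succ_of_le hd),
    eval_eq_sum_homogeneousComponent (Nat.lt_succ_of_le hd)]
  simp [Finset.sum_range_succ, h, h1]

theorem agreeInDegree_one_zero (hv : ∑ g, ρ g v = 0) : AgreeInDegree ρ 1 v 0 := by
  intro f hf hd
  have h1 := eval_homogeneousComponent_one_eq_zero hf (hd.trans one_le_two) hv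
  have h1' := eval_homogeneousComponent_one_eq_zero hf (hd.trans one_le_two)
    (v := 0) (by simp)
  rw [eval_eq_sum_homogeneousComponent (Nat.lt_succ_of_le hd),
    eval_eq_sum_homogeneousComponent (Nat.lt_succ_of_le hd)]
  simp only [Finset.sum_range_succ, Finset.sum_range_zero, h1, h1', zero_add, add_zero]
  exact eval_of_isHomogeneous_zero (homogeneousComponent_isHomogeneous 0 f) _ _

theorem not_separatesInDegree_one (hv : ∑ g, ρ g v = 0) (hv0 : v ≠ 0) :
    ¬ SeparatesInDegree ρ 1 := by
  intro h
  have h := separatesInDegree_iff.1 h _ _ (agreeInDegree_one_zero hv)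
  obtain ⟨g, hg⟩ := h ▸ mem_orbit_self ρ v
  exact hv0 (by simpa using hg.symm)

theorem not_separatesInDegree_two (hG : Odd (Nat.card G)) (hv : ∑ g, ρ g v = 0) (hv0 : v ≠ 0) :
    ¬ SeparatesInDegree ρ 2 := by
  intro h
  have h := separatesInDegree_iff.1 h _ _ (agreeInDegree_two_neg hv)
  obtain ⟨g, hg⟩ := h.symm ▸ mem_orbit_self ρ (-v)
  -- `g` acts on `v` by `-1`, so `g ^ |G| = 1` does as well.
  have hpow (n : ℕ) : ρ (g ^ n) v = (-1 : F) ^ n • v := by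
    induction n with
    | zero => simp
    | succ n ih =>
      have hg' : ρ g v = -v := hg
      rw [pow_succ, map_mul, Module.End.mul_apply, hg', map_neg, ih, pow_succ]
      simp
  have := hpow (Nat.card G)
  rw [pow_card_eq_one', hG.neg_one_pow, map_one, neg_one_smul, Module.End.one_apply] at this
  have h2 : (2 : F) • v = 0 := by
    rw [two_smul]
    nth_rewrite 1 [this]
    exact neg_add_cancel v
  exact hv0 ((smul_eq_zero.1 h2).resolve_left two_ne_zero)

end LowerBound

/-! ### The regular representation -/

section Regular

variable (F : Type*) [Field F] {G α : Type*} [Group G]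

/-- The regular representation of `G`, on functions on a type `α` identified with `G` by `e`.
The type `α` may live in another universe than `G`. -/
def regularRep (e : G ≃ α) : Representation F G (α → F) where
  toFun g := LinearMap.funLeft F F fun a => e (g⁻¹ * e.symm a)
  map_one' := by ext; simp
  map_mul' g h := by
    refine LinearMap.ext fun v => funext fun a => ?_
    simp [LinearMap.funLeft_apply, mul_assoc]

theorem exists_ne_zero_sum_regularRep_eq_zero [Fintype G] [Nontrivial G] (e : G ≃ α) :
    ∃ v : α → F, v ≠ 0 ∧ ∑ g, regularRep F e g v = 0 := by
  classical
  obtain ⟨x, hx⟩ := exists_ne (1 : G)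
  refine ⟨Pi.single (e 1) 1 - Pi.single (e x) 1, fun h => ?_, ?_⟩
  · have := congrFun h (e 1)
    simp [hx.symm] at this
  · ext a
    have h (y : G) : ∑ g, (Pi.single (e y) 1 : α → F) (e (g⁻¹ * e.symm a)) = 1 := by
      rw [Finset.sum_eq_single (e.symm a * y⁻¹)]
      · simp
      · intro g _ hg
        refine Pi.single_eq_of_ne (fun hc => hg ?_) _
        rw [← e.injective hc]
        group
      · simp
    simp [regularRep, LinearMap.funLeft_apply, h]

end Regular

/-! ### The separating Noether number -/

section Numbers

variable {F : Type*} [Field F] {G : Type*} [Group G] {V : Type*} [AddCommGroup V] [Module F V]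
  [FiniteDimensional F V] {ρ : Representation F G V}

theorem betaSep_le {d : ℕ} (hd : 0 < d) (h : SeparatesInDegree ρ d) : betaSep ρ ≤ d :=
  sInf_le ⟨d, hd, h, rfl⟩

theorem succ_le_betaSep {d : ℕ} (h : ¬ SeparatesInDegree ρ d) : ((d + 1 : ℕ) : ℕ∞) ≤ betaSep ρ := by
  refine le_sInf ?_
  rintro _ ⟨e, -, he, rfl⟩
  exact Nat.cast_le.2 (Nat.lt_of_not_le fun hed => h (he.mono hed))

end Numbers

/-- The space `V` on which degree `d` does not suffice attains the supremum. -/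
theorem separatingNoetherNumber_eq_and_mem {F : Type*} [Field F] {G : Type*} [Group G] {d : ℕ}
    (h : ∀ (V : Type w) [AddCommGroup V] [Module F V] [FiniteDimensional F V]
      (ρ : Representation F G V), SeparatesInDegree ρ (d + 1))
    {V : Type w} [AddCommGroup V] [Module F V] [FiniteDimensional F V]
    {ρ : Representation F G V} (hρ : ¬ SeparatesInDegree ρ d) :
    separatingNoetherNumber.{_, _, w} F G = (d + 1 : ℕ) ∧
      separatingNoetherNumber.{_, _, w} F G ∈ betaSepValues.{_, _, w} F G := by
  have hmem : ((d + 1 : ℕ) : ℕ∞) ∈ betaSepValues.{_, _, w} F G :=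
    ⟨V, _, _, inferInstance, ρ,
      (succ_le_betaSep hρ).antisymm (betaSep_le d.succ_pos (h V ρ))⟩
  have heq : separatingNoetherNumber.{_, _, w} F G = (d + 1 : ℕ) := by
    refine le_antisymm (sSup_le ?_) (le_sSup hmem)
    rintro _ ⟨W, _, _, _, σ, rfl⟩
    exact betaSep_le d.succ_pos (h W σ)
  exact ⟨heq, heq ▸ hmem⟩

end SepInv

theorem corollary4p2 (p : ℕ) (hp : p.Prime) (G : Type u) [Group G] [IsCyclic G]
    (hG : Nat.card G = p) :
    -- the value of the separating Noether number
    SepInv.separatingNoetherNumber.{u, 0, w} ℚ G = (if p = 2 then 2 else 3) ∧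
    -- the supremum defining it is a maximum
    SepInv.separatingNoetherNumber.{u, 0, w} ℚ G ∈ SepInv.betaSepValues.{u, 0, w} ℚ G ∧
    -- invariants of degree at most 3 separate the orbits of every rational representation
    (∀ (V : Type w) [AddCommGroup V] [Module ℚ V] [FiniteDimensional ℚ V]
      (ρ : Representation ℚ G V), SepInv.SeparatesInDegree ρ 3) := by
  have : Fact p.Prime := ⟨hp⟩
  have : Finite G := Nat.finite_of_card_ne_zero (hG ▸ hp.ne_zero)
  have := Fintype.ofFinite G
  have : Nontrivial G := Finite.one_lt_card_iff_nontrivial.1 (hG ▸ hp.one_lt)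
  have upper (d : ℕ) (hd : 2 ≤ d) (hd' : p ≠ 2 → 3 ≤ d) (V : Type w) [AddCommGroup V]
      [Module ℚ V] [FiniteDimensional ℚ V] (ρ : Representation ℚ G V) :
      SepInv.SeparatesInDegree ρ d :=
    SepInv.separatesInDegree_iff.2 fun _ _ h => h.orbit_eq hG hd hd'
  -- A copy of `G` in the universe of the representation spaces.
  let e : G ≃ ULift.{w} (Fin (Nat.card G)) := (Finite.equivFin G).trans Equiv.ulift.symm
  obtain ⟨v, hv0, hv⟩ := SepInv.exists_ne_zero_sum_regularRep_eq_zero ℚ e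
  rw [← and_assoc]
  refine ⟨?_, fun V _ _ _ ρ => upper 3 (by simp) (by simp) V ρ⟩
  by_cases h2 : p = 2
  · rw [if_pos h2]
    exact SepInv.separatingNoetherNumber_eq_and_mem
      (fun V _ _ _ ρ => upper 2 le_rfl (fun h => (h h2).elim) V ρ)
      (SepInv.not_separatesInDegree_one hv hv0)
  · rw [if_neg h2]
    exact SepInv.separatingNoetherNumber_eq_and_mem
      (fun V _ _ _ ρ => upper 3 (by simp) (by simp) V ρ)
      (SepInv.not_separatesInDegree_two (hG ▸ hp.odd_of_ne_two h2) hv hv0)
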